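/- Let $K\ge 2$, $1\le M\le N$, $1\le T\le N$ be integers and let $\mathbb F_q$ be a finite field. A database consists of $K$ independent files $W_1,\dots,W_K$, each made of $L$ independent uniform symbols of $\mathbb F_q$. Every file is encoded by a linear $(N,M)$-MDS code: node $n\in\{1,\dots,N\}$ stores $L/M$ symbols, $\mathbb F_q$-linear functions of the file, and the symbols stored at any $M$ nodes determine the file; $D_n$ denotes everything stored at node $n$. The desired file index $\kappa$ (which takes each value in $\{1,\dots,K\}$ with positive probability), the user's private randomness $\mathcal U$, the common randomness $S$ of the nodes (with a countable alphabet) and the database are mutually independent. In a linear scheme, the query $Q_n^{[k]}$ to node $n$ when file $k$ is desired is a function of $\mathcal U$ and consists of a fixed number $d_n$ of vectors over $\mathbb F_q$; the answer $A_n^{[k]}=\langle Q_n^{[k]},D_n\rangle+S_n\in\mathbb F_q^{d_n}$ consists of the inner products of these vectors with $D_n$, plus a vector $S_n\in\mathbb F_q^{d_n}$ that is a function of $S$. Write $\mathcal Q$ for the collection of all $Q_n^{[k]}$. The scheme is a $T$-private SPIR (symmetric private information retrieval) scheme if * for every $k$, $W_k$ can be decoded with zero error from $A^{[k]}_{1},\dots,A^{[k]}_N$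 and $\mathcal Q$; * (user-privacy) $I(\kappa;\,Q^{[\kappa]}_{\mathcal T},A^{[\kappa]}_{\mathcal T},D_{\mathcal T},S)=0$ for every set $\mathcal T$ of $T$ nodes; * (database-privacy) $I(W_{\bar\kappa};\,A^{[\kappa]}_{1},\dots,A^{[\kappa]}_{N},\mathcal Q,\kappa)=0$, where $W_{\bar\kappa}$ is the tuple of all files except $W_\kappa$. Theorem. For any linear $T$-private SPIR scheme for an $(N,M)$-MDS coded database and any $k\in\{1,\dots,K\}$ with nonzero rate $H(W_k)/\sum_{n=1}^N H(A_n^{[k]})>0$, one has $N\ge M+T$, and the secrecy rate satisfies $$\frac{H(S)}{H(W_k)}\;\ge\;\frac{M+T-1}{N-M-T+1}.$$ -/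

import Mathlib

open MeasureTheory ProbabilityTheory
open scoped ENNReal

noncomputable section

namespace SPIR

/-- Shannon entropy (in nats) of a random variable `X` with a countable alphabet,
as an extended nonnegative real: `H(X) = -∑ₓ P(X = x) log P(X = x)`. -/
def entropy {Ω α : Type*} [MeasurableSpace Ω] [Countable α] (μ : Measure Ω) (X : Ω → α) : ℝ≥0∞ :=
  ∑' x : α, ENNReal.ofReal (Real.negMulLog (μ.real (X ⁻¹' {x})))

/-- Mutual information `I(X ; Y)`: the Kullback-Leibler divergence of the joint law of `(X, Y)`
from the product of the marginal laws. -/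
def mutualInfo {Ω α β : Type*} [MeasurableSpace Ω] [MeasurableSpace α] [MeasurableSpace β]
    (μ : Measure Ω) (X : Ω → α) (Y : Ω → β) : ℝ≥0∞ :=
  InformationTheory.klDiv (μ.map fun ω => (X ω, Y ω)) ((μ.map X).prod (μ.map Y))

/-- A linear `(N, M)`-MDS storage code for `K` separately encoded files of `L` symbols of `F`.
Node `n` stores `ℓ = L / M` symbols `enc k n w` of the file `w` with index `k`, and the contents of
any `M` nodes determine the file.  (Since `L = M * ℓ`, the contents of any `M` nodes are then
linearly independent.  A scalar code with an `M × N` generator matrix, applied row by row to a file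
written as an `ℓ × M` matrix, is an instance.) -/
structure MDSStorage (F : Type*) [Field F] (K N M L ℓ : ℕ) where
  enc : Fin K → Fin N → (Fin L → F) →ₗ[F] (Fin ℓ → F)
  length_eq : L = M * ℓ
  mds : ∀ (k : Fin K) (I : Finset (Fin N)), I.card = M →
    Function.Injective fun (w : Fin L → F) (n : I) => enc k n w

/-- The increasing enumeration of the file indices other than `k`. -/
def otherIndex {K : ℕ} (k : Fin K) (j : Fin (K - 1)) : Fin K :=
  if j.val < k.val then ⟨j.val, by omega⟩ else ⟨j.val + 1, by omega⟩

/-- A linear retrieval scheme for an `(N, M)`-MDS coded database of `K` files over the finite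
field `F`, on a probability space `(Ω, μ)`; `𝒰` and `𝒮` are the alphabets of the private randomness
of the user and of the common randomness of the nodes.  No decodability or privacy is built in. -/
structure LinearScheme (F : Type*) [Field F] [Fintype F] [MeasurableSpace F]
    {Ω : Type*} [MeasurableSpace Ω] (μ : Measure Ω)
    (𝒰 : Type*) [MeasurableSpace 𝒰] (𝒮 : Type*) [MeasurableSpace 𝒮] (K N M : ℕ) where
  /-- file length -/
  L : ℕ
  /-- number of symbols per file stored at a node -/
  ℓ : ℕ
  /-- storage code -/
  code : MDSStorage F K N M L ℓ
  /-- database: `W ω k` is the file with index `k` -/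
  W : Ω → Fin K → Fin L → F
  /-- desired file index -/
  κ : Ω → Fin K
  /-- private randomness of the user -/
  U : Ω → 𝒰
  /-- common randomness of the nodes -/
  S : Ω → 𝒮
  /-- number of symbols in the answer of a node -/
  ansLen : Fin N → ℕ
  /-- the query sent to node `n` when file `k` is desired; it consists of
  `ansLen n` query vectors -/
  query : 𝒰 → Fin K → (n : Fin N) → Fin (ansLen n) → Fin K × Fin ℓ → F
  /-- the part `S_n` of the common randomness used by node `n`, as a function of `S` -/
  mask : (n : Fin N) → 𝒮 → Fin (ansLen n) → F
  measurable_W : Measurable W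
  measurable_κ : Measurable κ
  measurable_U : Measurable U
  measurable_S : Measurable S
  measurable_query : Measurable query
  /-- the files are independent and consist of independent uniform symbols -/
  uniform_W : ∀ w, μ (W ⁻¹' {w}) = (Fintype.card (Fin K → Fin L → F) : ℝ≥0∞)⁻¹
  /-- every file index is desired with positive probability -/
  κ_pos : ∀ k, 0 < μ (κ ⁻¹' {k})
  /-- the next three fields: `W`, `κ`, `U`, `S` are mutually independent -/
  indep_W : IndepFun W (fun ω => (κ ω, U ω, S ω)) μ
  indep_κ : IndepFun κ (fun ω => (U ω, S ω)) μ
  indep_U : IndepFun U S μ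

namespace LinearScheme

variable {F : Type*} [Field F] [Fintype F] [MeasurableSpace F]
  {Ω : Type*} [MeasurableSpace Ω] {μ : Measure Ω}
  {𝒰 : Type*} [MeasurableSpace 𝒰] {𝒮 : Type*} [MeasurableSpace 𝒮] {K N M : ℕ}

/-- `Q_n^{[k]}`, the query to node `n` when file `k` is desired. -/
def Q (P : LinearScheme F μ 𝒰 𝒮 K N M) (k : Fin K) (n : Fin N) (ω : Ω) :
    Fin (P.ansLen n) → Fin K × Fin P.ℓ → F :=
  P.query (P.U ω) k n

/-- The complete query scheme: all queries to all nodes for all desired file indices. -/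
def allQ (P : LinearScheme F μ 𝒰 𝒮 K N M) (ω : Ω) :
    Fin K → (n : Fin N) → Fin (P.ansLen n) → Fin K × Fin P.ℓ → F :=
  fun k n => P.Q k n ω

/-- `D_n`, the data stored at node `n`. -/
def D (P : LinearScheme F μ 𝒰 𝒮 K N M) (n : Fin N) (ω : Ω) : Fin K × Fin P.ℓ → F :=
  fun p => P.code.enc p.1 n (P.W ω p.1) p.2

/-- `A_n^{[k]} = ⟨Q_n^{[k]}, D_n⟩ + S_n`, the answer of node `n` when file `k` is desired. -/
def A (P : LinearScheme F μ 𝒰 𝒮 K N M) (k : Fin K) (n : Fin N) (ω : Ω) :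
    Fin (P.ansLen n) → F :=
  fun a => P.Q k n ω a ⬝ᵥ P.D n ω + P.mask n (P.S ω) a

/-- The files other than the desired one, in increasing order of their indices. -/
def otherFiles (P : LinearScheme F μ 𝒰 𝒮 K N M) (ω : Ω) : Fin (K - 1) → Fin P.L → F :=
  fun j => P.W ω (otherIndex (P.κ ω) j)

/-- Zero-error decoding of the desired file from all answers and the query scheme. -/
def Decodable (P : LinearScheme F μ 𝒰 𝒮 K N M) : Prop :=
  ∀ k : Fin K, ∃ dec : ((n : Fin N) → Fin (P.ansLen n) → F) →
      (Fin K → (n : Fin N) → Fin (P.ansLen n) → Fin K × Fin P.ℓ → F) → (Fin P.L → F),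
    ∀ᵐ ω ∂μ, dec (fun n => P.A k n ω) (P.allQ ω) = P.W ω k

/-- User-privacy against any `T` colluding nodes:
`I(κ ; Q_𝒯^{[κ]}, A_𝒯^{[κ]}, D_𝒯, S) = 0` for every set `𝒯` of `T` nodes. -/
def UserPrivate (P : LinearScheme F μ 𝒰 𝒮 K N M) (T : ℕ) : Prop :=
  ∀ I : Finset (Fin N), I.card = T →
    mutualInfo μ P.κ (fun ω =>
      ((fun n : I => P.Q (P.κ ω) n ω), (fun n : I => P.A (P.κ ω) n ω),
        (fun n : I => P.D n ω), P.S ω)) = 0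

/-- Database-privacy: `I(W_κ̄ ; A_{[1:N]}^{[κ]}, 𝒬, κ) = 0`. -/
def DatabasePrivate (P : LinearScheme F μ 𝒰 𝒮 K N M) : Prop :=
  mutualInfo μ P.otherFiles (fun ω => ((fun n => P.A (P.κ ω) n ω), P.allQ ω, P.κ ω)) = 0

/-- A (good) `T`-private SPIR scheme. -/
structure IsTPrivateSPIR (P : LinearScheme F μ 𝒰 𝒮 K N M) (T : ℕ) : Prop where
  decodable : P.Decodable
  userPrivate : P.UserPrivate T
  databasePrivate : P.DatabasePrivate

/-- The rate `H(W_k) / ∑_n H(A_n^{[k]})`. -/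
def rate (P : LinearScheme F μ 𝒰 𝒮 K N M) (k : Fin K) : ℝ≥0∞ :=
  entropy μ (fun ω => P.W ω k) / ∑ n, entropy μ (P.A k n)

/-- The secrecy rate `H(S) / H(W_k)`. -/
def secrecyRate [Countable 𝒮] (P : LinearScheme F μ 𝒰 𝒮 K N M) (k : Fin K) : ℝ≥0∞ :=
  entropy μ P.S / entropy μ (fun ω => P.W ω k)

end LinearScheme

end SPIR

end

set_option linter.unusedSectionVars false

noncomputable section

/-! Fix one query collection `q` of positive probability, and let `σ` be the law of the mask vector
`V = (S_1, ..., S_N)`. All information constraints become statements about `σ` and the homomorphisms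
sending files to unmasked answers, so no conditional entropy is needed. Decodability and
database-privacy force `σ` to be invariant under translation by the response to any undesired files
(`measure_masks_add_respond`). By the MDS property the desired file splits into summands, each
vanishing at all but one of `M` given nodes. Among `M + T - 1` nodes such a summand is visible to at
most `T`, and user-privacy lets these `T` nodes take it for part of an undesired file. So the
marginal of `σ` on any `J` with `M ≤ |J| ≤ M + T - 1` is also invariant under responses to the
desired file (`fiberMass_add_respondFile`). Put `m = M + T - 1` and let `X` be the response to a
uniform desired file plus an independent `V`. Decoding gives `H(X) = H(W_k) + H(V)`, invariance
gives `H(X_J) = H(V_J) ≤ H(V)`. If `N ≤ m`, taking all nodes for `J` is a contradiction; otherwise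
Shearer's inequality over the `N` cyclic windows of length `m` yields `m (H(W_k) + H(V)) ≤ N H(V)`,
and `H(V) ≤ H(S)` (`log_card_mul_le_of_hidden`, `entropy_comp_le`). -/

open Classical in
/-- The mass of the fiber of `f` through `x`, for the weights `p`. -/
def fiberMass {α β : Type*} [Fintype α] (p : α → ℝ) (f : α → β) (x : α) : ℝ :=
  ∑ y, if f y = f x then p y else 0

/-- The Shannon entropy of the random variable `f` on the finite space with weights `p`. -/
def weightedEntropy {α β : Type*} [Fintype α] (p : α → ℝ) (f : α → β) : ℝ :=
  -∑ x, p x * Real.log (fiberMass p f x)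

/-! ### Entropy on a finite weighted space, and its submodularity. -/

section WeightedEntropy

variable {α β γ δ : Type*} [Fintype α] {p : α → ℝ}

lemma fiberMass_congr {f : α → β} {g : α → γ} {x y : α} (h : ∀ z, f z = f x ↔ g z = g y) :
    fiberMass p f x = fiberMass p g y := by
  unfold fiberMass
  exact Finset.sum_congr rfl fun z _ => by
    by_cases hz : f z = f x
    · rw [if_pos hz, if_pos ((h z).1 hz)]
    · rw [if_neg hz, if_neg (mt (h z).2 hz)]

lemma fiberMass_def [DecidableEq β] (f : α → β) (x : α) :
    fiberMass p f x = ∑ y, if f y = f x then p y else 0 := by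
  unfold fiberMass
  congr! 2

lemma le_fiberMass (hp : ∀ x, 0 ≤ p x) (f : α → β) (x : α) : p x ≤ fiberMass p f x := by
  classical
  unfold fiberMass
  have := Finset.single_le_sum (f := fun y => if f y = f x then p y else 0)
    (fun y _ => by split_ifs <;> simp [hp]) (Finset.mem_univ x)
  simpa using this

lemma fiberMass_nonneg (hp : ∀ x, 0 ≤ p x) (f : α → β) (x : α) : 0 ≤ fiberMass p f x :=
  (hp x).trans (le_fiberMass hp f x)

lemma fiberMass_congr_point {f : α → β} {x y : α} (h : f x = f y) :
    fiberMass p f x = fiberMass p f y :=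
  fiberMass_congr fun z => by rw [h]

lemma weightedEntropy_congr {f : α → β} {g : α → γ} (h : ∀ x y, f x = f y ↔ g x = g y) :
    weightedEntropy p f = weightedEntropy p g := by
  unfold weightedEntropy
  congr 1
  exact Finset.sum_congr rfl fun x _ => by rw [fiberMass_congr fun z => h z x]

/-- Only points of positive weight are compared, so `g` need determine `f` almost surely only;
zero-error decoding enters in this form. -/
lemma weightedEntropy_mono (hp : ∀ x, 0 ≤ p x) {f : α → β} {g : α → γ}
    (h : ∀ x y, 0 < p x → 0 < p y → g x = g y → f x = f y) :
    weightedEntropy p f ≤ weightedEntropy p g := by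
  classical
  unfold weightedEntropy
  refine neg_le_neg (Finset.sum_le_sum fun x _ => ?_)
  rcases (hp x).eq_or_lt with hx | hx
  · simp [← hx]
  refine mul_le_mul_of_nonneg_left (Real.log_le_log (hx.trans_le (le_fiberMass hp g x)) ?_) hx.le
  refine Finset.sum_le_sum fun y _ => ?_
  rcases (hp y).eq_or_lt with hy | hy
  · simp [← hy]
  · by_cases hg : g y = g x
    · simp [hg, h y x hy hx hg]
    · rw [if_neg hg]; split_ifs <;> simp [hp]

lemma weightedEntropy_const (hp1 : ∑ x, p x = 1) {f : α → β} (h : ∀ x y, f x = f y) :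
    weightedEntropy p f = 0 := by
  have : ∀ x, fiberMass p f x = 1 := fun x => by
    rw [← hp1]
    exact Finset.sum_congr rfl fun y _ => if_pos (h y x)
  simp [weightedEntropy, this]

lemma weightedEntropy_injective {f : α → β} (h : Function.Injective f) :
    weightedEntropy p f = ∑ x, Real.negMulLog (p x) := by
  classical
  simp [weightedEntropy, fiberMass, h.eq_iff, Real.negMulLog]

/-- The ratio is the density of the law making `f` and `g` conditionally independent given `h`,
relative to the joint law; its mean can fall short of the total mass because the joint law may miss
part of the support. -/
lemma sum_ratio_fiberMass_le (hp : ∀ x, 0 ≤ p x) (f : α → β) (g : α → γ) (h : α → δ) :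
    ∑ x, p x * (fiberMass p (fun x => (f x, h x)) x * fiberMass p (fun x => (g x, h x)) x /
      (fiberMass p (fun x => (f x, g x, h x)) x * fiberMass p h x)) ≤ ∑ x, p x := by
  classical
  set m := fiberMass p (fun x => (f x, g x, h x)) with hm
  -- The two masses in the numerator are expanded as sums over `y` and `z`. For fixed `y`, `z` the
  -- admissible `x` form at most one fiber of `(f, g, h)`, whose mass cancels `m x`.
  have key : ∀ y z, ∑ x, (if f y = f x ∧ h y = h x then (if g z = g x ∧ h z = h x then
      p x / (m x * fiberMass p h x) else 0) else 0) ≤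
        if h z = h y then (fiberMass p h y)⁻¹ else 0 := by
    intro y z
    by_cases hzy : h z = h y
    swap
    · rw [if_neg hzy, Finset.sum_eq_zero]
      intro x _
      split_ifs with h1 h2
      · exact absurd (h2.2.trans h1.2.symm) hzy
      · rfl
      · rfl
    rw [if_pos hzy]
    by_cases hex : ∃ x, (f y = f x ∧ h y = h x) ∧ (g z = g x ∧ h z = h x)
    swap
    · rw [Finset.sum_eq_zero]
      · exact inv_nonneg.2 (fiberMass_nonneg hp _ _)
      intro x _
      split_ifs with h1 h2
      · exact absurd ⟨x, h1, h2⟩ hex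
      · rfl
      · rfl
    obtain ⟨x₀, ⟨h1, h2⟩, h3, h4⟩ := hex
    have : ∀ x, (if f y = f x ∧ h y = h x then (if g z = g x ∧ h z = h x then
        p x / (m x * fiberMass p h x) else 0) else 0) =
        (if (f x, g x, h x) = (f x₀, g x₀, h x₀) then p x else 0) *
          (m x₀ * fiberMass p h y)⁻¹ := by
      intro x
      by_cases hx : (f x, g x, h x) = (f x₀, g x₀, h x₀)
      · have hx' := hx
        simp only [Prod.mk.injEq] at hx'
        obtain ⟨a, b, c⟩ := hx'
        rw [if_pos ⟨by rw [h1, a], by rw [h2, c]⟩, if_pos ⟨by rw [h3, b], by rw [h4, c]⟩,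
          if_pos hx, div_eq_mul_inv]
        congr 3
        · exact fiberMass_congr_point hx
        · exact fiberMass_congr_point (by rw [h2, c])
      · rw [if_neg hx, zero_mul]
        split_ifs with a b
        · exact absurd (by rw [Prod.mk.injEq, Prod.mk.injEq, ← a.1, ← a.2, ← b.1, h1, h2, h3]; simp) hx
        · rfl
        · rfl
    rw [Finset.sum_congr rfl fun x _ => this x, ← Finset.sum_mul]
    rw [← fiberMass_def (fun x => (f x, g x, h x)) x₀, ← hm, mul_inv, ← mul_assoc]
    refine mul_le_of_le_one_left (inv_nonneg.2 (fiberMass_nonneg hp _ _)) ?_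
    exact mul_inv_le_one
  calc _ = ∑ y, ∑ z, p y * (p z * ∑ x, (if f y = f x ∧ h y = h x then
        (if g z = g x ∧ h z = h x then p x / (m x * fiberMass p h x) else 0) else 0)) := by
        simp only [Finset.mul_sum]
        rw [Finset.sum_congr rfl fun y _ => Finset.sum_comm, Finset.sum_comm]
        refine Finset.sum_congr rfl fun x _ => ?_
        have : fiberMass p (fun x => (f x, h x)) x * fiberMass p (fun x => (g x, h x)) x =
          ∑ y, ∑ z, (if f y = f x ∧ h y = h x then p y else 0) *
            (if g z = g x ∧ h z = h x then p z else 0) := by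
          rw [← Finset.sum_mul_sum]; simp [fiberMass]
        rw [this, mul_div_assoc', mul_comm, ← mul_div_assoc', Finset.sum_mul]
        refine Finset.sum_congr rfl fun y _ => ?_
        rw [Finset.sum_mul]
        refine Finset.sum_congr rfl fun z _ => ?_
        split_ifs <;> ring
    _ ≤ ∑ y, ∑ z, p y * (p z * if h z = h y then (fiberMass p h y)⁻¹ else 0) := by
        gcongr with y _ z _
        · exact hp y
        · exact hp z
        · exact key y z
    _ = ∑ y, p y * (fiberMass p h y * (fiberMass p h y)⁻¹) := by
        refine Finset.sum_congr rfl fun y _ => ?_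
        rw [← Finset.mul_sum]
        conv_rhs => enter [2, 1]; unfold fiberMass
        rw [Finset.sum_mul]
        congr 1
        exact Finset.sum_congr rfl fun z _ => by split_ifs <;> simp
    _ ≤ _ := by
        refine Finset.sum_le_sum fun y _ => mul_le_of_le_one_right (hp y) ?_
        exact mul_inv_le_one

/-- This is nonnegativity of the conditional mutual information of `f` and `g` given `h`, from `log
t ≤ t - 1` applied to the preceding ratio. -/
lemma weightedEntropy_submodular (hp : ∀ x, 0 ≤ p x) (f : α → β) (g : α → γ) (h : α → δ) :
    weightedEntropy p (fun x => (f x, g x, h x)) + weightedEntropy p h ≤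
      weightedEntropy p (fun x => (f x, h x)) + weightedEntropy p (fun x => (g x, h x)) := by
  have hs := sum_ratio_fiberMass_le hp f g h
  unfold weightedEntropy
  suffices ∑ x, p x * (Real.log (fiberMass p (fun x => (f x, h x)) x) +
      Real.log (fiberMass p (fun x => (g x, h x)) x) -
      Real.log (fiberMass p (fun x => (f x, g x, h x)) x) - Real.log (fiberMass p h x)) ≤ 0 by
    simp only [mul_sub, mul_add, Finset.sum_sub_distrib, Finset.sum_add_distrib] at this
    linarith
  refine le_trans (Finset.sum_le_sum (g := fun x => p x * (fiberMass p (fun x => (f x, h x)) x *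
    fiberMass p (fun x => (g x, h x)) x /
      (fiberMass p (fun x => (f x, g x, h x)) x * fiberMass p h x)) - p x) fun x _ => ?_) ?_
  · rcases (hp x).eq_or_lt with hx | hx
    · simp [← hx]
    have h1 := hx.trans_le (le_fiberMass hp (fun x => (f x, h x)) x)
    have h2 := hx.trans_le (le_fiberMass hp (fun x => (g x, h x)) x)
    have h3 := hx.trans_le (le_fiberMass hp (fun x => (f x, g x, h x)) x)
    have h4 := hx.trans_le (le_fiberMass hp h x)
    rw [← mul_sub_one]
    refine mul_le_mul_of_nonneg_left ?_ hx.le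
    refine le_trans (le_of_eq ?_) (Real.log_le_sub_one_of_pos (by positivity))
    rw [Real.log_div (by positivity) (by positivity), Real.log_mul h1.ne' h2.ne',
      Real.log_mul h3.ne' h4.ne']
    ring
  · rw [Finset.sum_sub_distrib]; linarith

end WeightedEntropy

/-! ### Shearer's inequality and the cyclic windows. -/

/-- Shearer's inequality for set functions with diminishing marginal returns. -/
lemma shearer_of_submodular {ν ι : Type*} [DecidableEq ν] [Fintype ι] (H : Finset ν → ℝ)
    (h0 : H ∅ = 0)
    (hsub : ∀ (A B : Finset ν) (n : ν), A ⊆ B → H (insert n B) + H A ≤ H (insert n A) + H B)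
    (J : ι → Finset ν) (m : ℕ) (hJ : ∀ n, (Finset.univ.filter fun i => n ∈ J i).card = m)
    (s : Finset ν) : m * H s ≤ ∑ i, H (J i ∩ s) := by
  induction s using Finset.induction_on with
  | empty => simp [h0]
  | insert n s hn ih =>
    -- Adding `n` to the smaller set `J i ∩ s` gains at least as much as adding it to `s`; exactly
    -- `m` indices `i` have this gain.
    have step : ∀ i, H (J i ∩ s) + (if n ∈ J i then H (insert n s) - H s else 0) ≤
        H (J i ∩ insert n s) := by
      intro i
      split_ifs with hi
      · rw [Finset.inter_insert_of_mem hi]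
        linarith [hsub (J i ∩ s) s n Finset.inter_subset_right]
      · rw [Finset.inter_insert_of_notMem hi, add_zero]
    have := Finset.sum_le_sum fun i (_ : i ∈ Finset.univ) => step i
    rw [Finset.sum_add_distrib, ← Finset.sum_filter, Finset.sum_const, hJ, nsmul_eq_mul] at this
    linarith

/-- Shearer's inequality for the entropy of the coordinates of a random tuple. -/
lemma shearer_weightedEntropy {α ν ι : Type*} {E : ν → Type*} [Fintype α] [Fintype ν]
    [DecidableEq ν] [Fintype ι] {p : α → ℝ} (hp : ∀ x, 0 ≤ p x) (hp1 : ∑ x, p x = 1)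
    (X : α → ∀ n, E n) (J : ι → Finset ν) (m : ℕ)
    (hJ : ∀ n, (Finset.univ.filter fun i => n ∈ J i).card = m) :
    m * weightedEntropy p X ≤ ∑ i, weightedEntropy p fun x => (J i).restrict (X x) := by
  have hr : ∀ (A : Finset ν) (x y : α), A.restrict (X x) = A.restrict (X y) ↔
      ∀ n ∈ A, X x n = X y n := fun A x y => by simp [funext_iff]
  have key : ∀ H : Finset ν → ℝ, H ∅ = 0 → (∀ (A B : Finset ν) (n : ν), A ⊆ B →
      H (insert n B) + H A ≤ H (insert n A) + H B) → m * H Finset.univ ≤ ∑ i, H (J i) :=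
    fun H h0 hs => by simpa using shearer_of_submodular H h0 hs J m hJ Finset.univ
  have := key (fun A => weightedEntropy p fun x => A.restrict (X x))
    (weightedEntropy_const hp1 fun x y => by simp [hr]) ?_
  · refine le_trans (le_of_eq ?_) this
    congr 1
    exact weightedEntropy_congr fun x y => by rw [hr]; simp [funext_iff]
  · intro A B n hAB
    have := weightedEntropy_submodular hp (fun x => X x n) (fun x => B.restrict (X x))
      (fun x => A.restrict (X x))
    refine le_trans (le_of_eq ?_) (this.trans (le_of_eq ?_))
    · congr 1
      refine weightedEntropy_congr fun x y => ?_
      simp only [Prod.mk.injEq, hr, Finset.forall_mem_insert]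
      exact ⟨fun h => ⟨h.1, h.2, fun i hi => h.2 i (hAB hi)⟩, fun h => ⟨h.1, h.2.1⟩⟩
    · congr 1
      · refine weightedEntropy_congr fun x y => ?_
        simp only [Prod.mk.injEq, hr, Finset.forall_mem_insert]
      · refine weightedEntropy_congr fun x y => ?_
        simp only [Prod.mk.injEq, hr]
        exact ⟨fun h => h.1, fun h => ⟨h, fun i hi => h i (hAB hi)⟩⟩

/-- The interval of length `m` that starts at `i`, in the cyclic order. -/
def cyclicWindow {N : ℕ} [NeZero N] (m : ℕ) (i : Fin N) : Finset (Fin N) :=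
  Finset.univ.filter fun n => (n - i).val < m

lemma card_filter_val_lt {N m : ℕ} (h : m ≤ N) :
    (Finset.univ.filter fun n : Fin N => n.val < m).card = m := by
  rw [Fin.card_filter_val_lt, min_eq_right h]

lemma card_cyclicWindow {N m : ℕ} [NeZero N] (h : m ≤ N) (i : Fin N) :
    (cyclicWindow m i).card = m := by
  conv_rhs => rw [← card_filter_val_lt h]
  exact Finset.card_equiv (Equiv.subRight i) fun n => by simp [cyclicWindow]

/-- As `i` runs over the cyclic group, so does `n - i`. Hence the `N` windows cover every node
equally often, as Shearer's inequality requires. -/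
lemma card_filter_mem_cyclicWindow {N m : ℕ} [NeZero N] (h : m ≤ N) (n : Fin N) :
    (Finset.univ.filter fun i => n ∈ cyclicWindow m i).card = m := by
  conv_rhs => rw [← card_filter_val_lt h]
  exact Finset.card_equiv (Equiv.subLeft n) fun i => by simp [cyclicWindow]

/-! ### Randomness needed to hide a uniform secret. -/

/-- The joint weights of a uniform element of `A` and an independent variable with weights `σ`. -/
def uniformProd (A : Type*) [Fintype A] {B : Type*} (σ : B → ℝ) (x : A × B) : ℝ :=
  (Fintype.card A : ℝ)⁻¹ * σ x.2

lemma sum_uniformProd_mul {A B : Type*} [Fintype A] [Nonempty A] [Fintype B] (σ g : B → ℝ) :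
    ∑ x, uniformProd A σ x * g x.2 = ∑ v, σ v * g v := by
  have : (Fintype.card A : ℝ) ≠ 0 := by simp
  rw [Fintype.sum_prod_type]
  simp only [uniformProd, mul_assoc, ← Finset.mul_sum, Finset.sum_const, Finset.card_univ,
    nsmul_eq_mul]
  rw [← mul_assoc, inv_mul_cancel₀ this, one_mul]

lemma sum_negMulLog_uniformProd {A B : Type*} [Fintype A] [Nonempty A] [Fintype B] {σ : B → ℝ}
    (hσ1 : ∑ v, σ v = 1) :
    ∑ x, Real.negMulLog (uniformProd A σ x) =
      Real.log (Fintype.card A) + ∑ v, Real.negMulLog (σ v) := by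
  have hc : (Fintype.card A : ℝ) ≠ 0 := by simp
  rw [Fintype.sum_prod_type]
  simp only [uniformProd, Real.negMulLog_mul, Finset.sum_add_distrib, ← Finset.mul_sum,
    ← Finset.sum_mul, hσ1, Finset.sum_const, Finset.card_univ, nsmul_eq_mul]
  simp only [Real.negMulLog, Real.log_inv]
  field_simp

section SharedRandomness

variable {N : ℕ} {E : Fin N → Type*} [∀ n, Fintype (E n)] [∀ n, AddCommGroup (E n)]
  {A : Type*} [Fintype A] [AddCommGroup A] {σ : (∀ n, E n) → ℝ} {G : A →+ ∀ n, E n}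

/-- If the restriction of `σ` to `J` is invariant under `G`, the coordinates in `J` of a translate
of `σ` by a uniform element of the image of `G` have the same entropy as those of `σ`. -/
lemma weightedEntropy_restrict_translate (J : Finset (Fin N))
    (hinv : ∀ w v, fiberMass σ J.restrict (v + G w) = fiberMass σ J.restrict v) :
    weightedEntropy (uniformProd A σ) (fun x => J.restrict (G x.1 + x.2)) =
      weightedEntropy σ J.restrict := by
  classical
  have hc : (Fintype.card A : ℝ) ≠ 0 := by simp
  have hm : ∀ x : A × ∀ n, E n, fiberMass (uniformProd A σ) (fun x => J.restrict (G x.1 + x.2)) x =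
      fiberMass σ J.restrict x.2 := by
    rintro ⟨w, v⟩
    -- For each `w'` the condition says that `v'` agrees on `J` with `v + G (w - w')`; by invariance
    -- the mass does not depend on `w'`.
    have h1 : ∀ w', ∑ v', (if J.restrict (G w' + v') = J.restrict (G w + v) then
        uniformProd A σ (w', v') else 0) = (Fintype.card A : ℝ)⁻¹ * fiberMass σ J.restrict v := by
      intro w'
      rw [← hinv (w - w') v, fiberMass_def, Finset.mul_sum]
      refine Finset.sum_congr rfl fun v' _ => ?_
      have : J.restrict (G w' + v') = J.restrict (G w + v) ↔
          J.restrict v' = J.restrict (v + G (w - w')) := by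
        simp only [funext_iff, Finset.restrict, map_sub, Pi.add_apply, Pi.sub_apply]
        refine forall_congr' fun n => ?_
        constructor
        · intro h
          rw [add_sub_assoc', add_comm (v n), ← h]; abel
        · intro h
          rw [h]; abel
      rw [if_congr this rfl rfl, mul_ite, mul_zero, uniformProd]
    rw [fiberMass_def, Fintype.sum_prod_type]
    simp only [h1, Finset.sum_const, Finset.card_univ, nsmul_eq_mul]
    rw [← mul_assoc, mul_inv_cancel₀ hc, one_mul]
  simp only [weightedEntropy, hm]
  rw [sum_uniformProd_mul (A := A) σ (fun v => Real.log (fiberMass σ J.restrict v))]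

/-- The amount of randomness `σ` needed to hide a uniform secret in `A` from all sets of between
`M` and `m` coordinates, when all coordinates together reveal it. -/
theorem log_card_mul_le_of_hidden {M m : ℕ} (hMN : M ≤ N) (hMm : M ≤ m)
    [Nontrivial A] (hσ : ∀ v, 0 ≤ σ v) (hσ1 : ∑ v, σ v = 1)
    (hdec : ∀ w w' v v', 0 < σ v → 0 < σ v' → G w + v = G w' + v' → w = w')
    (hinv : ∀ J : Finset (Fin N), M ≤ J.card → J.card ≤ m →
      ∀ w v, fiberMass σ J.restrict (v + G w) = fiberMass σ J.restrict v) :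
    m < N ∧ m * Real.log (Fintype.card A) ≤ (N - m) * ∑ v, Real.negMulLog (σ v) := by
  have hc : (0 : ℝ) < Fintype.card A := by exact_mod_cast Fintype.card_pos
  have hp : ∀ x, 0 ≤ uniformProd A σ x := fun x => mul_nonneg (inv_nonneg.2 hc.le) (hσ _)
  have hp1 : ∑ x, uniformProd A σ x = 1 := by
    simpa [hσ1] using sum_uniformProd_mul (A := A) σ (fun _ => 1)
  have hlog : 0 < Real.log (Fintype.card A) :=
    Real.log_pos (by exact_mod_cast Fintype.one_lt_card)
  set X : A × (∀ n, E n) → ∀ n, E n := fun x => G x.1 + x.2 with hX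
  -- The translate reveals `w`, and subtracting `G w` then reveals `v`.
  have hXlow : Real.log (Fintype.card A) + ∑ v, Real.negMulLog (σ v) ≤
      weightedEntropy (uniformProd A σ) X := by
    rw [← sum_negMulLog_uniformProd hσ1, ← weightedEntropy_injective (f := id) Function.injective_id]
    refine weightedEntropy_mono hp fun x y hx hy h => ?_
    have hw := hdec x.1 y.1 x.2 y.2 (pos_of_mul_pos_right hx (inv_nonneg.2 hc.le))
      (pos_of_mul_pos_right hy (inv_nonneg.2 hc.le)) h
    refine Prod.ext hw ?_
    simpa [hX, hw] using h
  have hXJ : ∀ J : Finset (Fin N), M ≤ J.card → J.card ≤ m →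
      weightedEntropy (uniformProd A σ) (fun x => J.restrict (X x)) ≤
        ∑ v, Real.negMulLog (σ v) := fun J h1 h2 => by
    rw [weightedEntropy_restrict_translate J (hinv J h1 h2),
      ← weightedEntropy_injective (f := id) Function.injective_id]
    exact weightedEntropy_mono hσ fun x y _ _ h => by rw [id_eq, id_eq] at h; rw [h]
  have hmN : m < N := by
    by_contra! h
    -- If `N ≤ m`, the set of all nodes is admissible, leaving no room in `X` for the positive
    -- entropy of the secret.
    have h1 := hXJ Finset.univ (by simpa using hMN) (by simpa using h)
    have h2 : weightedEntropy (uniformProd A σ) (fun x => Finset.univ.restrict (X x)) =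
        weightedEntropy (uniformProd A σ) X :=
      weightedEntropy_congr fun x y => by simp [funext_iff]
    linarith
  refine ⟨hmN, ?_⟩
  have : NeZero N := ⟨by omega⟩
  have hsh := shearer_weightedEntropy hp hp1 X (cyclicWindow m) m
    (card_filter_mem_cyclicWindow hmN.le)
  have hsum := Finset.sum_le_sum fun i (_ : i ∈ Finset.univ) =>
    hXJ (cyclicWindow m i) (by rw [card_cyclicWindow hmN.le]; exact hMm)
      (by rw [card_cyclicWindow hmN.le])
  rw [Finset.sum_const, Finset.card_univ, Fintype.card_fin, nsmul_eq_mul] at hsum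
  have := mul_le_mul_of_nonneg_left hXlow (Nat.cast_nonneg (α := ℝ) m)
  nlinarith

end SharedRandomness

/-! ### Entropy, independence and uniformity on the probability space. -/

section Probability

variable {Ω : Type*} [MeasurableSpace Ω] {μ : Measure Ω} [IsProbabilityMeasure μ]

lemma ofReal_negMulLog_toReal {a : ℝ≥0∞} (ha : a ≤ 1) :
    ENNReal.ofReal (Real.negMulLog a.toReal) = a * ENNReal.ofReal (-Real.log a.toReal) := by
  rw [Real.negMulLog, neg_mul_comm, ENNReal.ofReal_mul ENNReal.toReal_nonneg,
    ENNReal.ofReal_toReal (ne_top_of_le_ne_top ENNReal.one_ne_top ha)]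

/-- A function of a random variable has at most its entropy. -/
lemma entropy_comp_le {𝒮 V : Type*} [Countable 𝒮] [Finite V] [MeasurableSpace 𝒮]
    [DiscreteMeasurableSpace 𝒮] {X : Ω → 𝒮} (hX : Measurable X) (g : 𝒮 → V) :
    SPIR.entropy μ (g ∘ X) ≤ SPIR.entropy μ X := by
  unfold SPIR.entropy
  rw [← ENNReal.tsum_fiberwise _ g]
  refine ENNReal.tsum_le_tsum fun v => ?_
  have hpre : (g ∘ X) ⁻¹' {v} = X ⁻¹' (g ⁻¹' {v}) := rfl
  have hsum : ∑' b : g ⁻¹' {v}, μ (X ⁻¹' {↑b}) = μ ((g ∘ X) ⁻¹' {v}) :=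
    tsum_measure_preimage_singleton (Set.to_countable _) fun _ _ =>
      hX (measurableSet_singleton _)
  -- The mass of the fiber over `v` is distributed over its points `b`; each is no likelier than the
  -- fiber, so its `-log` is no smaller. Extended values allow infinite entropy of `X`.
  rw [measureReal_def, ofReal_negMulLog_toReal prob_le_one, ← hsum, ← ENNReal.tsum_mul_right, hsum]
  refine ENNReal.tsum_le_tsum fun b => ?_
  rw [measureReal_def, ofReal_negMulLog_toReal prob_le_one]
  rcases eq_or_ne (μ (X ⁻¹' {↑b})) 0 with h0 | h0
  · simp [h0]
  gcongr
  · exact ENNReal.toReal_pos h0 (measure_ne_top _ _)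
  · exact measure_ne_top _ _
  · rw [hpre]
    exact Set.preimage_mono (Set.singleton_subset_iff.2 b.2)

lemma indepFun_of_mutualInfo_eq_zero {α β : Type*} [MeasurableSpace α] [MeasurableSpace β]
    {X : Ω → α} {Y : Ω → β} (hX : Measurable X) (hY : Measurable Y)
    (h : SPIR.mutualInfo μ X Y = 0) : IndepFun X Y μ := by
  have := Measure.isProbabilityMeasure_map (μ := μ) hX.aemeasurable
  have := Measure.isProbabilityMeasure_map (μ := μ) hY.aemeasurable
  rw [indepFun_iff_map_prod_eq_prod_map_map hX.aemeasurable hY.aemeasurable]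
  exact InformationTheory.klDiv_eq_zero_iff.1 h

lemma sum_measure_preimage_singleton_univ {V : Type*} [Fintype V] [MeasurableSpace V]
    [MeasurableSingletonClass V] {X : Ω → V} (hX : Measurable X) :
    ∑ v, μ (X ⁻¹' {v}) = 1 := by
  rw [sum_measure_preimage_singleton _ fun _ _ => hX (measurableSet_singleton _)]
  simp

lemma sum_measureReal_preimage_singleton_univ {V : Type*} [Fintype V] [MeasurableSpace V]
    [MeasurableSingletonClass V] {X : Ω → V} (hX : Measurable X) :
    ∑ v, μ.real (X ⁻¹' {v}) = 1 := by
  simp only [measureReal_def]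
  rw [← ENNReal.toReal_sum fun _ _ => measure_ne_top _ _, sum_measure_preimage_singleton_univ hX,
    ENNReal.toReal_one]

lemma exists_measure_preimage_singleton_pos {V : Type*} [Finite V] [MeasurableSpace V]
    [MeasurableSingletonClass V] {X : Ω → V} (hX : Measurable X) :
    ∃ v, 0 < μ (X ⁻¹' {v}) := by
  have := Fintype.ofFinite V
  by_contra! h
  have h1 := sum_measure_preimage_singleton_univ (μ := μ) hX
  simp [fun v => le_antisymm (h v) bot_le] at h1

/-- The image of a uniform variable under a surjective homomorphism of groups is uniform. -/
lemma measure_preimage_singleton_of_uniform {B H : Type*} [Fintype B] [AddCommGroup B]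
    [Fintype H] [AddCommGroup H] [MeasurableSpace B] [MeasurableSingletonClass B]
    {X : Ω → B} (hX : Measurable X)
    (hunif : ∀ b, μ (X ⁻¹' {b}) = (Fintype.card B : ℝ≥0∞)⁻¹)
    (f : B →+ H) (hf : Function.Surjective f) (h : H) :
    μ ((fun ω => f (X ω)) ⁻¹' {h}) = (Fintype.card H : ℝ≥0∞)⁻¹ := by
  classical
  let _ : MeasurableSpace H := ⊤
  have hpre : ∀ h, μ ((fun ω => f (X ω)) ⁻¹' {h}) =
      (Finset.univ.filter fun b => f b = h).card * (Fintype.card B : ℝ≥0∞)⁻¹ := by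
    intro h
    rw [← nsmul_eq_mul, ← Finset.sum_const, Finset.sum_congr rfl fun b _ => (hunif b).symm,
      sum_measure_preimage_singleton _ fun _ _ => hX (measurableSet_singleton _)]
    congr 1
    ext ω
    simp
  have hconst : ∀ h', μ ((fun ω => f (X ω)) ⁻¹' {h'}) = μ ((fun ω => f (X ω)) ⁻¹' {h}) := by
    intro h'
    rw [hpre, hpre, AddMonoidHom.card_fiber_eq_of_mem_range f (hf h') (hf h)]
  have hsum := sum_measure_preimage_singleton_univ (μ := μ) (X := fun ω => f (X ω))
    ((measurable_of_finite f).comp hX)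
  rw [Finset.sum_congr rfl fun h' _ => hconst h', Finset.sum_const, Finset.card_univ,
    nsmul_eq_mul, mul_comm] at hsum
  exact ENNReal.eq_inv_of_mul_eq_one_left hsum

lemma entropy_eq_of_uniform {H : Type*} [Fintype H] [Nonempty H] {X : Ω → H}
    (h : ∀ x, μ (X ⁻¹' {x}) = (Fintype.card H : ℝ≥0∞)⁻¹) :
    SPIR.entropy μ X = ENNReal.ofReal (Real.log (Fintype.card H)) := by
  have hc : (Fintype.card H : ℝ) ≠ 0 := by simp
  have : ∀ x, μ.real (X ⁻¹' {x}) = (Fintype.card H : ℝ)⁻¹ := fun x => by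
    simp [measureReal_def, h]
  simp only [SPIR.entropy, this, tsum_fintype, Finset.sum_const, Finset.card_univ, nsmul_eq_mul]
  rw [Real.negMulLog, Real.log_inv, ← ENNReal.ofReal_natCast,
    ← ENNReal.ofReal_mul (Nat.cast_nonneg _)]
  congr 1
  field_simp

end Probability

lemma fiberMass_add_of_invariant {V β : Type*} [Fintype V] [AddCommGroup V] {σ : V → ℝ}
    {f : V → β} {g : V} (hf : ∀ x y, f (x + g) = f (y + g) ↔ f x = f y)
    (hg : ∀ v, σ (v + g) = σ v) (v : V) : fiberMass σ f (v + g) = fiberMass σ f v := by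
  classical
  rw [fiberMass_def, fiberMass_def]
  refine (Equiv.sum_comp (Equiv.addRight g) _).symm.trans ?_
  simp [hg, hf]

/-! ### File indices and interpolation in the MDS code. -/

namespace SPIR

lemma otherIndex_injective {K : ℕ} (k : Fin K) : Function.Injective (otherIndex k) := by
  intro i j h
  simp only [otherIndex] at h
  split_ifs at h <;> simp only [Fin.mk.injEq] at h <;> ext <;> omega

lemma exists_otherIndex_eq {K : ℕ} {k i : Fin K} (h : i ≠ k) : ∃ j, otherIndex k j = i := by
  have hne : i.val ≠ k.val := fun e => h (Fin.ext e)
  rcases lt_or_ge i.val k.val with hlt | hge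
  · exact ⟨⟨i, by omega⟩, by simp [otherIndex, hlt]⟩
  · refine ⟨⟨i - 1, by omega⟩, ?_⟩
    have : ¬ (i.val - 1 < k.val) := by omega
    simp only [otherIndex, this, if_false]
    ext
    simp only
    omega

/-- Since `L = M * ℓ`, the injective map to the contents of `M` nodes is between spaces of equal
dimension, hence onto. -/
lemma MDSStorage.exists_enc_eq {F : Type*} [Field F] {K N M L ℓ : ℕ} (C : MDSStorage F K N M L ℓ)
    (k : Fin K) {I : Finset (Fin N)} (hI : I.card = M) (y : I → Fin ℓ → F) :
    ∃ w, ∀ n : I, C.enc k n w = y n := by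
  have hf : Module.finrank F (Fin L → F) = Module.finrank F (I → Fin ℓ → F) := by
    simp [C.length_eq, hI, Module.finrank_pi_fintype]
  obtain ⟨w, hw⟩ := (LinearMap.injective_iff_surjective_of_finrank_eq_finrank hf
    (f := LinearMap.pi fun n : I => C.enc k n)).1 (C.mds k I hI) y
  exact ⟨w, fun n => congrFun hw n⟩

/-- A file is a sum of files, each of which is stored as zero at all but one of `M` given nodes. -/
lemma MDSStorage.exists_decomposition {F : Type*} [Field F] {K N M L ℓ : ℕ}
    (C : MDSStorage F K N M L ℓ) (k : Fin K) {I : Finset (Fin N)} (hI : I.card = M)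
    (w : Fin L → F) :
    ∃ x : I → Fin L → F, w = ∑ n, x n ∧ ∀ n m : I, m ≠ n → C.enc k m (x n) = 0 := by
  choose x hx using fun n : I => C.exists_enc_eq k hI (Pi.single n (C.enc k n w))
  refine ⟨x, C.mds k I hI (funext fun m => ?_), fun n m h => by rw [hx, Pi.single_eq_of_ne h]⟩
  simp only [map_sum, hx]
  rw [Finset.sum_pi_single m _ Finset.univ, if_pos (Finset.mem_univ m)]

/-! ### The scheme as a finite random state with a product law. -/

namespace LinearScheme

variable {F : Type*} [Field F] [Fintype F] [MeasurableSpace F] [DiscreteMeasurableSpace F]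
  {Ω : Type*} [MeasurableSpace Ω] {μ : Measure Ω} [IsProbabilityMeasure μ]
  {𝒰 : Type*} [MeasurableSpace 𝒰] {𝒮 : Type*} [MeasurableSpace 𝒮]
  [DiscreteMeasurableSpace 𝒮] {K N M T : ℕ} (P : LinearScheme F μ 𝒰 𝒮 K N M)

/-- The joint queries to all nodes, for one desired file. -/
abbrev Queries : Type _ := (n : Fin N) → Fin (P.ansLen n) → Fin K × Fin P.ℓ → F

/-- The joint answers of all nodes. -/
abbrev Answers : Type _ := (n : Fin N) → Fin (P.ansLen n) → F

/-- The inner products of the query vectors with the data that the nodes store. -/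
def respond (q : P.Queries) : (Fin K → Fin P.L → F) →+ P.Answers :=
  AddMonoidHom.mk' (fun w n a => q n a ⬝ᵥ fun p => P.code.enc p.1 n (w p.1) p.2) fun w w' => by
    funext n a
    simp only [Pi.add_apply, map_add]
    exact dotProduct_add _ _ _

/-- The common randomness added to the answers of all nodes. -/
def masks (ω : Ω) : P.Answers := fun n => P.mask n (P.S ω)

lemma A_eq (k : Fin K) (ω : Ω) :
    (fun n => P.A k n ω) = P.respond (P.allQ ω k) (P.W ω) + P.masks ω := rfl

lemma measurable_allQ : Measurable P.allQ := P.measurable_query.comp P.measurable_U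

lemma measurable_masks : Measurable P.masks :=
  (Measurable.of_discrete (f := fun s : 𝒮 => (fun n => P.mask n s : P.Answers))).comp P.measurable_S

/-- All the variables with finite alphabets that determine the run of the scheme. -/
def state (ω : Ω) : (Fin K → Fin P.L → F) × Fin K × (Fin K → P.Queries) × P.Answers :=
  (P.W ω, P.κ ω, P.allQ ω, P.masks ω)

lemma measurable_state : Measurable P.state :=
  P.measurable_W.prodMk (P.measurable_κ.prodMk (P.measurable_allQ.prodMk P.measurable_masks))

lemma measurable_comp_state {β : Type*} [MeasurableSpace β]
    (f : (Fin K → Fin P.L → F) × Fin K × (Fin K → P.Queries) × P.Answers → β) :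
    Measurable fun ω => f (P.state ω) :=
  (measurable_of_finite f).comp P.measurable_state

lemma measure_state_eq (w : Fin K → Fin P.L → F) (j : Fin K) (q : Fin K → P.Queries)
    (v : P.Answers) :
    μ (P.state ⁻¹' {(w, j, q, v)}) = μ (P.W ⁻¹' {w}) *
      (μ (P.κ ⁻¹' {j}) * (μ (P.allQ ⁻¹' {q}) * μ (P.masks ⁻¹' {v}))) := by
  have hq : MeasurableSet {u | P.query u = q} := P.measurable_query (measurableSet_singleton q)
  have hv : MeasurableSet {s | (fun n => P.mask n s : P.Answers) = v} := .of_discrete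
  have h3 := P.indep_U.measure_inter_preimage_eq_mul _ _ hq hv
  have h2 := P.indep_κ.measure_inter_preimage_eq_mul _ _ (measurableSet_singleton j) (hq.prod hv)
  have h1 := P.indep_W.measure_inter_preimage_eq_mul _ _ (measurableSet_singleton w)
    ((measurableSet_singleton j).prod (hq.prod hv))
  have e1 : P.state ⁻¹' {(w, j, q, v)} = P.W ⁻¹' {w} ∩ (fun ω => (P.κ ω, P.U ω, P.S ω)) ⁻¹'
      ({j} ×ˢ {u | P.query u = q} ×ˢ {s | (fun n => P.mask n s : P.Answers) = v}) := by
    ext ω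
    simp only [state, Set.mem_preimage, Set.mem_singleton_iff, Prod.mk.injEq, Set.mem_inter_iff,
      Set.mem_prod, Set.mem_ofPred_eq]
    rfl
  rw [e1, h1]
  congr 1
  refine Eq.trans ?_ (h2.trans ?_)
  · rfl
  · congr 1

lemma measure_W_pos (w : Fin K → Fin P.L → F) : 0 < μ (P.W ⁻¹' {w}) := by
  rw [P.uniform_W]
  exact ENNReal.inv_pos.2 (ENNReal.natCast_ne_top _)

lemma measure_state_pos (w : Fin K → Fin P.L → F) (j : Fin K) {q : Fin K → P.Queries}
    {v : P.Answers} (hq : 0 < μ (P.allQ ⁻¹' {q})) (hv : 0 < μ (P.masks ⁻¹' {v})) :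
    0 < μ (P.state ⁻¹' {(w, j, q, v)}) := by
  rw [measure_state_eq]
  exact ENNReal.mul_pos (P.measure_W_pos w).ne' (ENNReal.mul_pos (P.κ_pos j).ne'
    (ENNReal.mul_pos hq.ne' hv.ne').ne').ne'

/-- An almost sure property holds at every possible state. -/
lemma forall_state_of_ae {p : Ω → Prop} (hp : ∀ᵐ ω ∂μ, p ω) (w : Fin K → Fin P.L → F) (j : Fin K)
    {q : Fin K → P.Queries} {v : P.Answers} (hq : 0 < μ (P.allQ ⁻¹' {q}))
    (hv : 0 < μ (P.masks ⁻¹' {v})) : ∃ ω, p ω ∧ P.state ω = (w, j, q, v) := by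
  by_contra! h
  refine (P.measure_state_pos w j hq hv).ne' (measure_mono_null (fun ω hω => ?_) (ae_iff.1 hp))
  exact fun h' => h ω h' hω

/-- The files other than `j`, in increasing order of their indices. -/
def filesExcept (j : Fin K) : (Fin K → Fin P.L → F) →+ (Fin (K - 1) → Fin P.L → F) :=
  AddMonoidHom.mk' (fun w i => w (otherIndex j i)) fun _ _ => rfl

lemma filesExcept_surjective (j : Fin K) : Function.Surjective (P.filesExcept j) :=
  (otherIndex_injective j).surjective_comp_right

lemma eq_of_filesExcept_eq {j : Fin K} {w w' : Fin K → Fin P.L → F} (hj : w j = w' j)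
    (h : P.filesExcept j w = P.filesExcept j w') : w = w' := by
  funext i
  by_cases hi : i = j
  · rw [hi, hj]
  · obtain ⟨l, rfl⟩ := exists_otherIndex_eq hi
    exact congrFun h l

/-- Which files are listed depends on `κ`, but the list is uniform on each event `κ = j`, because
`W` is independent of `κ`. -/
lemma measure_otherFiles (x : Fin (K - 1) → Fin P.L → F) :
    μ (P.otherFiles ⁻¹' {x}) = (Fintype.card (Fin (K - 1) → Fin P.L → F) : ℝ≥0∞)⁻¹ := by
  classical
  have hind : IndepFun P.W P.κ μ := P.indep_W.comp measurable_id measurable_fst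
  have hdec : ∀ j, μ (P.otherFiles ⁻¹' {x} ∩ P.κ ⁻¹' {j}) =
      (Fintype.card (Fin (K - 1) → Fin P.L → F) : ℝ≥0∞)⁻¹ * μ (P.κ ⁻¹' {j}) := by
    intro j
    rw [← measure_preimage_singleton_of_uniform P.measurable_W P.uniform_W (P.filesExcept j)
      (P.filesExcept_surjective j) x]
    have := hind.measure_inter_preimage_eq_mul _ _
      (MeasurableSet.of_discrete (s := (P.filesExcept j) ⁻¹' {x})) (measurableSet_singleton j)
    refine Eq.trans ?_ this
    congr 1
    ext ω
    refine and_congr_left fun h => ?_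
    have h' : P.otherFiles ω = P.filesExcept j (P.W ω) := by
      unfold otherFiles
      rw [show P.κ ω = j from h]
      rfl
    rw [Set.mem_preimage, h']
    rfl
  have hs : P.otherFiles ⁻¹' {x} = ⋃ j ∈ (Finset.univ : Finset (Fin K)),
      (P.otherFiles ⁻¹' {x} ∩ P.κ ⁻¹' {j}) := by
    ext ω; simp
  have hof : Measurable P.otherFiles :=
    (measurable_of_finite (fun y : (Fin K → Fin P.L → F) × Fin K => P.filesExcept y.2 y.1)).comp
      (P.measurable_W.prodMk P.measurable_κ)
  rw [hs, measure_biUnion_finset]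
  · simp only [hdec]
    rw [← Finset.mul_sum, sum_measure_preimage_singleton_univ P.measurable_κ, mul_one]
  · intro i _ j _ hij
    refine Set.disjoint_left.2 fun ω hi hj => hij (hi.2.symm.trans hj.2)
  · exact fun j _ => (hof (measurableSet_singleton x)).inter
      (P.measurable_κ (measurableSet_singleton j))

/-! ### What decodability and privacy say about the law of the masks. -/

variable {P}

/-- The answers to a possible query under possible masks determine the desired file. -/
lemma Decodable.file_eq (hD : P.Decodable) (k : Fin K) {q : Fin K → P.Queries}
    (hq : 0 < μ (P.allQ ⁻¹' {q})) {w w' : Fin K → Fin P.L → F} {v v' : P.Answers}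
    (hv : 0 < μ (P.masks ⁻¹' {v})) (hv' : 0 < μ (P.masks ⁻¹' {v'}))
    (h : P.respond (q k) w + v = P.respond (q k) w' + v') : w k = w' k := by
  obtain ⟨dec, hdec⟩ := hD k
  obtain ⟨ω, h1, h2⟩ := P.forall_state_of_ae hdec w k hq hv
  obtain ⟨ω', h1', h2'⟩ := P.forall_state_of_ae hdec w' k hq hv'
  simp only [state, Prod.mk.injEq] at h2 h2'
  rw [P.A_eq, h2.1, h2.2.2.1, h2.2.2.2] at h1
  rw [P.A_eq, h2'.1, h2'.2.2.1, h2'.2.2.2] at h1'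
  rw [← h1, ← h1', h]

/-- Given answers `v`, query `q` and `κ = k`, all values of the undesired files are equally likely,
and each value fixes the masks. Comparing `w` with the zero database gives the invariance. -/
lemma measure_masks_sub_respond (hD : P.Decodable) (hDP : P.DatabasePrivate) (k : Fin K)
    {q : Fin K → P.Queries} (hq : 0 < μ (P.allQ ⁻¹' {q})) {v : P.Answers}
    (hv : 0 < μ (P.masks ⁻¹' {v})) {w : Fin K → Fin P.L → F} (hw : w k = 0) :
    μ (P.masks ⁻¹' {v - P.respond (q k) w}) = μ (P.masks ⁻¹' {v}) := by
  have hind : IndepFun P.otherFiles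
      (fun ω => ((fun n => P.A (P.κ ω) n ω), P.allQ ω, P.κ ω)) μ :=
    indepFun_of_mutualInfo_eq_zero
      (P.measurable_comp_state fun x => P.filesExcept x.2.1 x.1)
      (P.measurable_comp_state fun x =>
        (P.respond (x.2.2.1 x.2.1) x.1 + x.2.2.2, x.2.2.1, x.2.1)) hDP
  obtain ⟨dec, hdec⟩ := hD k
  -- Since `v` is a possible mask, the zero database can produce the answers `v`; so `v` always
  -- decodes to the zero file.
  have hdec0 : dec v q = 0 := by
    obtain ⟨ω, h1, h2⟩ := P.forall_state_of_ae hdec 0 k hq hv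
    simp only [state, Prod.mk.injEq] at h2
    rw [P.A_eq, h2.1, h2.2.2.1, h2.2.2.2] at h1
    simpa using h1
  have key : ∀ w : Fin K → Fin P.L → F, w k = 0 →
      μ (P.state ⁻¹' {(w, k, q, v - P.respond (q k) w)}) =
        (Fintype.card (Fin (K - 1) → Fin P.L → F) : ℝ≥0∞)⁻¹ *
          μ ((fun ω => ((fun n => P.A (P.κ ω) n ω), P.allQ ω, P.κ ω)) ⁻¹' {(v, q, k)}) := by
    intro w hw
    rw [← P.measure_otherFiles (P.filesExcept k w), ← hind.measure_inter_preimage_eq_mul _ _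
      (measurableSet_singleton _) (measurableSet_singleton _)]
    refine measure_congr ?_
    filter_upwards [hdec] with ω hω
    refine propext ?_
    change P.state ω = _ ↔ P.otherFiles ω = _ ∧ (_, _, _) = (_, _, _)
    simp only [state, Prod.mk.injEq]
    constructor
    · rintro ⟨h1, h2, h3, h4⟩
      refine ⟨?_, ?_, h3, h2⟩
      · rw [← h1, ← h2]; rfl
      · rw [P.A_eq, h1, h2, h3, h4]; abel
    · rintro ⟨h1, h2, h3, h4⟩
      rw [h4] at h2
      rw [h2, h3, hdec0] at hω
      have hW : P.W ω = w := P.eq_of_filesExcept_eq (hω.symm.trans hw.symm) (by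
        rw [← h1]; unfold otherFiles; rw [h4]; rfl)
      refine ⟨hW, h4, h3, ?_⟩
      rw [← h2, P.A_eq, hW, h3]; abel
  have h := (key w hw).trans (key 0 rfl).symm
  rw [map_zero, sub_zero, measure_state_eq, measure_state_eq, P.uniform_W, P.uniform_W] at h
  have hfin : ∀ s, μ s ≠ ⊤ := measure_ne_top μ
  rwa [ENNReal.mul_right_inj (ENNReal.inv_pos.2 (ENNReal.natCast_ne_top _)).ne' (by simp),
    ENNReal.mul_right_inj (P.κ_pos k).ne' (hfin _), ENNReal.mul_right_inj hq.ne' (hfin _)] at h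

/-- The law of the masks is invariant under the responses of undesired files. -/
lemma measure_masks_add_respond (hD : P.Decodable) (hDP : P.DatabasePrivate) (k : Fin K)
    {q : Fin K → P.Queries} (hq : 0 < μ (P.allQ ⁻¹' {q})) {w : Fin K → Fin P.L → F}
    (hw : w k = 0) (v : P.Answers) :
    μ (P.masks ⁻¹' {v + P.respond (q k) w}) = μ (P.masks ⁻¹' {v}) := by
  rcases (bot_le (a := μ (P.masks ⁻¹' {v}))).eq_or_lt with h0 | h0
  -- If `v` has mass zero but its translate does not, the previous lemma applied at the translate
  -- leads back to `v`.
  · by_contra hne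
    have hpos : 0 < μ (P.masks ⁻¹' {v + P.respond (q k) w}) :=
      pos_iff_ne_zero.2 fun h => hne (h.trans h0)
    have := measure_masks_sub_respond hD hDP k hq hpos hw
    rw [add_sub_cancel_right] at this
    exact hne this.symm
  · have := measure_masks_sub_respond hD hDP k hq h0 (w := -w) (by simp [hw])
    rwa [map_neg, sub_neg_eq_add] at this

/-- A possible query for one file looks to `T` nodes like a possible query for any other file. -/
lemma UserPrivate.exists_query_eq (hU : P.UserPrivate T) (k k' : Fin K) {q : Fin K → P.Queries}
    (hq : 0 < μ (P.allQ ⁻¹' {q})) {I : Finset (Fin N)} (hI : I.card = T) :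
    ∃ q', 0 < μ (P.allQ ⁻¹' {q'}) ∧ ∀ n ∈ I, q' k' n = q k n := by
  have hind := indepFun_of_mutualInfo_eq_zero P.measurable_κ
    ((P.measurable_comp_state fun x => fun n : I => x.2.2.1 x.2.1 n).prodMk
      ((P.measurable_comp_state fun x => fun n : I =>
        (P.respond (x.2.2.1 x.2.1) x.1 + x.2.2.2) n).prodMk
      ((P.measurable_comp_state fun x => fun n : I => fun p : Fin K × Fin P.ℓ =>
        P.code.enc p.1 n (x.1 p.1) p.2).prodMk P.measurable_S))) (hU I hI)
  have hind' : IndepFun P.κ (fun ω => fun n : I => P.Q (P.κ ω) n ω) μ :=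
    hind.comp measurable_id measurable_fst
  have hκ : IndepFun P.κ P.allQ μ :=
    P.indep_κ.comp measurable_id (P.measurable_query.comp measurable_fst)
  have h1 := hκ.measure_inter_preimage_eq_mul _ _ (measurableSet_singleton k)
    (measurableSet_singleton q)
  have h2 := hind'.measure_inter_preimage_eq_mul _ _ (measurableSet_singleton k')
    (measurableSet_singleton fun n : I => q k n)
  have hpos : 0 < μ ((fun ω => fun n : I => P.Q (P.κ ω) n ω) ⁻¹' {fun n : I => q k n}) := by
    refine lt_of_lt_of_le (h1 ▸ ENNReal.mul_pos (P.κ_pos k).ne' hq.ne') (measure_mono ?_)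
    rintro ω ⟨hk, hω⟩
    simp only [Set.mem_preimage, Set.mem_singleton_iff] at hk hω ⊢
    rw [hk, ← hω]; rfl
  -- The event that `κ = k'` and the nodes in `I` see `q k` has positive probability; it is covered
  -- by countably many events `allQ = q'`, which cannot all be null.
  by_contra! h
  refine (h2 ▸ ENNReal.mul_pos (P.κ_pos k').ne' hpos.ne').ne' (measure_mono_null ?_
    ((measure_preimage_eq_zero_iff_of_countable (f := P.allQ)
      (Set.to_countable {q' : Fin K → P.Queries | ∀ n ∈ I, q' k' n = q k n})).2 fun q' hq' => ?_))
  · rintro ω ⟨hk, hω⟩ n hn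
    simp only [Set.mem_preimage, Set.mem_singleton_iff] at hk hω
    rw [hk] at hω
    exact congrFun hω ⟨n, hn⟩
  · by_contra hne
    obtain ⟨n, hn, hne'⟩ := h q' (pos_iff_ne_zero.2 hne)
    exact hne' (hq' n hn)

/-- The response to a database in which only the file `k` is nonzero. -/
def respondFile (P : LinearScheme F μ 𝒰 𝒮 K N M) (q : P.Queries) (k : Fin K) :
    (Fin P.L → F) →+ P.Answers :=
  (P.respond q).comp (AddMonoidHom.single (fun _ : Fin K => Fin P.L → F) k)

lemma respondFile_congr {q q' : P.Queries} {n : Fin N} (h : q n = q' n) (k : Fin K)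
    (x : Fin P.L → F) : P.respondFile q k x n = P.respondFile q' k x n := by
  funext a
  simp only [respondFile, respond, AddMonoidHom.comp_apply, AddMonoidHom.mk'_apply, h]

lemma respondFile_eq_zero (q : P.Queries) {k : Fin K} {x : Fin P.L → F} {n : Fin N}
    (h : P.code.enc k n x = 0) : P.respondFile q k x n = 0 := by
  funext a
  refine (congrArg (q n a ⬝ᵥ ·) (funext fun p => ?_)).trans (dotProduct_zero _)
  simp only [AddMonoidHom.single_apply, Pi.zero_apply]
  by_cases hp : p.1 = k
  · rw [hp, Pi.single_eq_same, h]; rfl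
  · rw [Pi.single_eq_of_ne hp, map_zero]; rfl

/-- The law of the masks of at most `M + T - 1` nodes is invariant under the responses of the
desired file: a summand of the file that only `T` of these nodes see could as well be part of an
undesired file. -/
lemma IsTPrivateSPIR.fiberMass_add_respondFile (hP : P.IsTPrivateSPIR T) (hK : 2 ≤ K)
    (hTN : T ≤ N) (k : Fin K) {q : Fin K → P.Queries} (hq : 0 < μ (P.allQ ⁻¹' {q}))
    {J : Finset (Fin N)} (hMJ : M ≤ J.card) (hJ : J.card ≤ M + T - 1) (x : Fin P.L → F)
    (v : P.Answers) :
    fiberMass (fun v => μ.real (P.masks ⁻¹' {v})) J.restrict (v + P.respondFile (q k) k x) =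
      fiberMass (fun v => μ.real (P.masks ⁻¹' {v})) J.restrict v := by
  classical
  have : Nontrivial (Fin K) := Fin.nontrivial_iff_two_le.2 hK
  obtain ⟨k', hk'⟩ := exists_ne k
  obtain ⟨J', hJ', hcard⟩ := Finset.exists_subset_card_eq hMJ
  obtain ⟨y, rfl, hy⟩ := P.code.exists_decomposition k hcard x
  rw [map_sum]
  refine Finset.sum_induction (fun n => P.respondFile (q k) k (y n))
    (fun g => ∀ v, fiberMass (fun v => μ.real (P.masks ⁻¹' {v})) J.restrict (v + g) =
      fiberMass (fun v => μ.real (P.masks ⁻¹' {v})) J.restrict v)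
    (fun g g' hg hg' v => by rw [← add_assoc, hg', hg]) (fun v => by rw [add_zero]) ?_ v
  intro n _ v
  have hM : 1 ≤ M := hcard ▸ Finset.card_pos.2 ⟨n, n.2⟩
  -- The count is at most `1 + (M + T - 1) - M = T`.
  have hcardI : (insert n.1 (J \ J')).card ≤ T := by
    refine (Finset.card_insert_le _ _).trans ?_
    rw [Finset.card_sdiff_of_subset hJ', hcard]
    omega
  obtain ⟨I, hI, hIT⟩ := Finset.exists_superset_card_eq hcardI (by simpa using hTN)
  obtain ⟨q', hq', hqq'⟩ := hP.userPrivate.exists_query_eq k k' hq hIT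
  -- A node of `J` outside `I` lies in `J'` and is not `n`, so it stores zero for this summand and
  -- responds with zero to either query.
  have hrestr : J.restrict (v + P.respondFile (q k) k (y n)) =
      J.restrict (v + P.respondFile (q' k') k (y n)) := by
    funext m
    simp only [Finset.restrict, Pi.add_apply]
    congr 1
    by_cases hm : m.1 ∈ I
    · exact respondFile_congr (hqq' m hm).symm k _
    · have hmJ' : m.1 ∈ J' := by
        by_contra h
        exact hm (hI (Finset.mem_insert_of_mem (Finset.mem_sdiff.2 ⟨m.2, h⟩)))
      have hmn : m.1 ≠ n := fun h => hm (hI (h ▸ Finset.mem_insert_self _ _))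
      have h0 := hy n ⟨m, hmJ'⟩ fun h => hmn (congrArg Subtype.val h)
      rw [respondFile_eq_zero _ h0, respondFile_eq_zero _ h0]
  rw [fiberMass_congr_point hrestr]
  -- Under `q' k'` file `k` is undesired, so the whole law of the masks is invariant under this
  -- response, and so is its marginal on `J`.
  refine fiberMass_add_of_invariant (fun a b => ?_) (fun a => ?_) v
  · simp [funext_iff, Finset.restrict]
  · simp only [measureReal_def]
    exact congrArg ENNReal.toReal (measure_masks_add_respond hP.decodable hP.databasePrivate k' hq'
      (Pi.single_eq_of_ne hk' _) a)

/-! ### The bound for the masks and its transfer to `S`. -/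

/-- The trade-off between the file size and the entropy of the masks, in real numbers. -/
lemma IsTPrivateSPIR.log_card_le (hP : P.IsTPrivateSPIR T) (hK : 2 ≤ K) (hMN : M ≤ N)
    (hT : 1 ≤ T) (hTN : T ≤ N) (k : Fin K) (hL : P.L ≠ 0) :
    M + T - 1 < N ∧ (M + T - 1 : ℕ) * Real.log (Fintype.card (Fin P.L → F)) ≤
      (N - (M + T - 1 : ℕ)) * ∑ v, Real.negMulLog (μ.real (P.masks ⁻¹' {v})) := by
  obtain ⟨q, hq⟩ := exists_measure_preimage_singleton_pos P.measurable_allQ (μ := μ)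
  have : Nonempty (Fin P.L) := ⟨⟨0, Nat.pos_of_ne_zero hL⟩⟩
  have hpos : ∀ {v}, 0 < μ.real (P.masks ⁻¹' {v}) → 0 < μ (P.masks ⁻¹' {v}) :=
    fun h => (ENNReal.toReal_pos_iff.1 h).1
  refine log_card_mul_le_of_hidden (G := P.respondFile (q k) k) hMN (by omega)
    (fun _ => measureReal_nonneg)
    (sum_measureReal_preimage_singleton_univ P.measurable_masks) ?_ ?_
  · intro w w' v v' hv hv' h
    simpa using hP.decodable.file_eq k hq (hpos hv) (hpos hv') h
  · exact fun J h1 h2 => hP.fiberMass_add_respondFile hK hTN k hq h1 h2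

lemma entropy_file (P : LinearScheme F μ 𝒰 𝒮 K N M) (k : Fin K) :
    entropy μ (fun ω => P.W ω k) =
      ENNReal.ofReal (Real.log (Fintype.card (Fin P.L → F))) :=
  entropy_eq_of_uniform (measure_preimage_singleton_of_uniform P.measurable_W P.uniform_W
    (Pi.evalAddMonoidHom (fun _ : Fin K => Fin P.L → F) k) (Function.surjective_eval k))

lemma ofReal_sum_negMulLog_masks_le [Countable 𝒮] (P : LinearScheme F μ 𝒰 𝒮 K N M) :
    ENNReal.ofReal (∑ v, Real.negMulLog (μ.real (P.masks ⁻¹' {v}))) ≤ entropy μ P.S := by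
  refine le_trans (le_of_eq ?_)
    (entropy_comp_le P.measurable_S fun s => (fun n => P.mask n s : P.Answers))
  rw [entropy, tsum_fintype, ENNReal.ofReal_sum_of_nonneg fun v _ =>
    Real.negMulLog_nonneg measureReal_nonneg measureReal_le_one]
  rfl

end LinearScheme

end SPIR

end

theorem theorem3 {F : Type*} [Field F] [Fintype F] [MeasurableSpace F] [DiscreteMeasurableSpace F]
    {Ω : Type*} [MeasurableSpace Ω] (μ : Measure Ω) [IsProbabilityMeasure μ]
    {𝒰 : Type*} [MeasurableSpace 𝒰]
    {𝒮 : Type*} [MeasurableSpace 𝒮] [Countable 𝒮] [DiscreteMeasurableSpace 𝒮]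
    (K N M T : ℕ) (hK : 2 ≤ K) (hM : 1 ≤ M) (hMN : M ≤ N) (hT : 1 ≤ T) (hTN : T ≤ N)
    (P : SPIR.LinearScheme F μ 𝒰 𝒮 K N M) (hP : P.IsTPrivateSPIR T)
    (k : Fin K) (hrate : 0 < P.rate k) :
    M + T ≤ N ∧
      ENNReal.ofReal (((M : ℝ) + T - 1) / ((N : ℝ) - M - T + 1)) ≤ P.secrecyRate k := by
  -- Positive rate excludes files of length zero, so the secret is nontrivial and division by
  -- `H(W_k)` is legitimate.
  have hW : SPIR.entropy μ (fun ω => P.W ω k) ≠ 0 := fun h => by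
    simp [SPIR.LinearScheme.rate, h] at hrate
  have hlog : 0 < Real.log (Fintype.card (Fin P.L → F)) := by
    rw [P.entropy_file k] at hW
    exact ENNReal.ofReal_pos.1 (pos_iff_ne_zero.2 hW)
  have hL : P.L ≠ 0 := fun h => by
    simp [h] at hlog
  obtain ⟨hlt, hle⟩ := hP.log_card_le hK hMN hT hTN k hL
  refine ⟨by omega, ?_⟩
  have hcast : ((M + T - 1 : ℕ) : ℝ) = M + T - 1 := by
    rw [Nat.cast_sub (by omega)]; push_cast; ring
  have hden : (0 : ℝ) < N - M - T + 1 := by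
    have : ((M + T - 1 : ℕ) : ℝ) < N := by exact_mod_cast hlt
    rw [hcast] at this
    linarith
  rw [hcast] at hle
  rw [SPIR.LinearScheme.secrecyRate, P.entropy_file k, ENNReal.le_div_iff_mul_le
    (Or.inl (ENNReal.ofReal_pos.2 hlog).ne') (Or.inl ENNReal.ofReal_ne_top),
    ← ENNReal.ofReal_mul' hlog.le]
  refine le_trans (ENNReal.ofReal_le_ofReal ?_) P.ofReal_sum_negMulLog_masks_le
  rw [div_mul_eq_mul_div, div_le_iff₀ hden]
  linarith
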